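/- Let $\mathcal N=SL_2(\mathbb R[z,z^{-1}])$. Let $\mathcal D=\{\mathbf D_K=\mathrm{diag}(1/K,K): K\in\mathbb R\setminus\{0\}\}$, let $\mathcal P_a=\{S\in\mathbb R[z,z^{-1}]: S(z^{-1})=-S(z)\}$ be the group of whole-sample antisymmetric (WA) filters, and let $$\mathcal U=\left\{\begin{bmatrix}1&S\\0&1\end{bmatrix}: S\in\mathcal P_a\right\},\qquad \mathcal L=\left\{\begin{bmatrix}1&0\\S&1\end{bmatrix}: S\in\mathcal P_a\right\}$$ be the WA lifting matrix groups. Let $\mathcal C_{\mathfrak H}=\langle\mathcal U\cup\mathcal L\rangle$ be the lifting cascade group and $\mathcal S_{\mathfrak H}=\langle\mathcal D\cup\mathcal C_{\mathfrak H}\rangle$ the scaled lifting group. The unimodular half-sample symmetric (HS) class is $$\mathfrak H=\left\{\mathbf H\in\mathcal N:\ \mathbf H(z^{-1})=\begin{bmatrix}1&0\\0&-1\end{bmatrix}\mathbf H(z)\begin{bmatrix}0&1\\1&0\end{bmatrix}\right\}.$$ For $\mathbf H\in\mathcal N$ and $i=0,1$ let $H_i(z)=H_{i0}(z^2)+z\,H_{i1}(z^2)$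 be its scalar filters, and let the order of a nonzero Laurent polynomial be the difference of its highest and lowest exponents. Put $$\mathfrak B_{\mathfrak H}=\{\mathbf B\in\mathfrak H:\ \mathrm{order}(B_0)=\mathrm{order}(B_1)\},\qquad \mathfrak B'_{\mathfrak H}=\{\mathbf B\in\mathfrak B_{\mathfrak H}:\ B_0(1)=1\}.$$ 1. There is an isomorphism $\rho:\mathcal C_{\mathfrak H}\to\mathcal U*\mathcal L$ onto the free product that restricts to the canonical inclusions on $\mathcal U$ and $\mathcal L$. Let $\theta:\mathcal D\to\mathrm{Aut}(\mathcal U*\mathcal L)$ be the action by conjugation of each letter; then $\theta_{\mathbf D}=\rho\circ\gamma_{\mathbf D}\circ\rho^{-1}$ for every $\mathbf D\in\mathcal D$, where $\gamma_{\mathbf D}\mathbf E=\mathbf D\mathbf E\mathbf D^{-1}$ for $\mathbf E\in\mathcal C_{\mathfrak H}$, and $$\mathcal S_{\mathfrak H}\cong\mathcal D\ltimes_\theta(\mathcal U*\mathcal L)$$ through an isomorphism that sends $\mathbf D\mathbf E$ to the product of the images of $\mathbf D$ and $\rho(\mathbf E)$ in the semidirect product, for all $\mathbf D\in\mathcal D$,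 $\mathbf E\in\mathcal C_{\mathfrak H}$. 2. $\mathfrak H=\bigcup\{\mathcal C_{\mathfrak H}\mathbf B:\mathbf B\in\mathfrak B_{\mathfrak H}\}$, and the right cosets $\mathcal C_{\mathfrak H}\mathbf B$ for distinct $\mathbf B\in\mathfrak B_{\mathfrak H}$ are disjoint. 3. $\mathfrak H=\bigcup\{\mathcal S_{\mathfrak H}\mathbf B:\mathbf B\in\mathfrak B'_{\mathfrak H}\}$, and the right cosets $\mathcal S_{\mathfrak H}\mathbf B$ for distinct $\mathbf B\in\mathfrak B'_{\mathfrak H}$ are disjoint. 4. $\mathfrak H$ is not a union of left cosets $\mathbf A\,\mathcal C_{\mathfrak H}$ ($\mathbf A\in\mathcal N$), and it is not a union of left cosets $\mathbf A\,\mathcal S_{\mathfrak H}$ ($\mathbf A\in\mathcal N$). -/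

import Mathlib

open scoped LaurentPolynomial Pointwise

noncomputable section

namespace HSBank

/-- The unimodular group: `2 × 2` matrices of determinant `1` over `ℝ[z, z⁻¹]` (with `z = T 1`). -/
abbrev Unimod : Type := Matrix.SpecialLinearGroup (Fin 2) ℝ[T;T⁻¹]

/-- The gain-scaling matrix `D_K = diag(1/K, K)`, as a homomorphism in `K ∈ ℝ \ {0}`. -/
def gain : ℝˣ →* Unimod where
  toFun K := ⟨!![LaurentPolynomial.C ((K : ℝ)⁻¹), 0; 0, LaurentPolynomial.C (K : ℝ)], by
    rw [Matrix.det_fin_two_of, ← map_mul]; simp⟩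
  map_one' := by
    ext i j; fin_cases i <;> fin_cases j <;> simp
  map_mul' K K' := by
    apply Subtype.ext
    change _ = !![LaurentPolynomial.C ((K : ℝ)⁻¹), 0; 0, LaurentPolynomial.C (K : ℝ)] *
      !![LaurentPolynomial.C ((K' : ℝ)⁻¹), 0; 0, LaurentPolynomial.C (K' : ℝ)]
    simp [mul_comm]

/-- The upper triangular lifting matrix with lifting filter `S`. -/
def upsilon : Multiplicative ℝ[T;T⁻¹] →* Unimod where
  toFun S := ⟨!![1, S.toAdd; 0, 1], by simp [Matrix.det_fin_two_of]⟩
  map_one' := by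
    ext i j; fin_cases i <;> fin_cases j <;> simp
  map_mul' S S' := by
    apply Subtype.ext
    change _ = !![1, S.toAdd; 0, 1] * !![1, S'.toAdd; 0, 1]
    simp [add_comm]

/-- The lower triangular lifting matrix with lifting filter `S`. -/
def lambda : Multiplicative ℝ[T;T⁻¹] →* Unimod where
  toFun S := ⟨!![1, 0; S.toAdd, 1], by simp [Matrix.det_fin_two_of]⟩
  map_one' := by
    ext i j; fin_cases i <;> fin_cases j <;> simp
  map_mul' S S' := by
    apply Subtype.ext
    change _ = !![1, 0; S.toAdd, 1] * !![1, 0; S'.toAdd, 1]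
    simp

/-- Whole-sample antisymmetric (WA) filters: `S(z⁻¹) = -S(z)`. -/
def WA : AddSubgroup ℝ[T;T⁻¹] where
  carrier := {S | LaurentPolynomial.invert S = -S}
  zero_mem' := by simp
  add_mem' {a b} ha hb := by
    simp only [Set.mem_ofPred_eq] at *
    rw [map_add, ha, hb, neg_add]
  neg_mem' {a} ha := by
    simp only [Set.mem_ofPred_eq] at *
    rw [map_neg, ha]

/-- The group `𝒟` of all gain-scaling matrices. -/
def D : Subgroup Unimod := gain.range

/-- The group `𝒰` of upper triangular WA lifting matrices. -/
def U : Subgroup Unimod := (AddSubgroup.toSubgroup WA).map upsilon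

/-- The group `ℒ` of lower triangular WA lifting matrices. -/
def L : Subgroup Unimod := (AddSubgroup.toSubgroup WA).map lambda

/-- The lifting cascade group `𝒞 = ⟨𝒰 ∪ ℒ⟩`. -/
def Cas : Subgroup Unimod := Subgroup.closure ((U : Set Unimod) ∪ (L : Set Unimod))

/-- The scaled lifting group `𝒮 = ⟨𝒟 ∪ 𝒞⟩`. -/
def Sca : Subgroup Unimod := Subgroup.closure ((D : Set Unimod) ∪ (Cas : Set Unimod))

/-- The unimodular HS class `𝔥`: `H(z⁻¹) = diag(1, -1) H(z) J`, `J` the exchange matrix. -/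
def HS : Set Unimod :=
  {H | (H : Matrix (Fin 2) (Fin 2) ℝ[T;T⁻¹]).map LaurentPolynomial.invert =
    !![1, 0; 0, -1] * (H : Matrix (Fin 2) (Fin 2) ℝ[T;T⁻¹]) * !![0, 1; 1, 0]}

/-- The substitution `f(z) ↦ f(z²)`. -/
def substSq : ℝ[T;T⁻¹] →+* ℝ[T;T⁻¹] :=
  AddMonoidAlgebra.mapDomainRingHom ℝ (AddMonoidHom.mulLeft (2 : ℤ))

/-- The scalar filter with polyphase-with-advance components `H i 0`, `H i 1`:
`H_i(z) = H_{i0}(z²) + z H_{i1}(z²)`. -/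
def filt (H : Unimod) (i : Fin 2) : ℝ[T;T⁻¹] :=
  substSq (H.1 i 0) + LaurentPolynomial.T 1 * substSq (H.1 i 1)

open Classical in
/-- The order `b - a` of a filter whose lowest and highest exponents are `a` and `b`
(set to `0` for the zero filter, which is never a row of an invertible matrix). -/
def order (f : ℝ[T;T⁻¹]) : ℤ :=
  if h : f.coeff.support.Nonempty then f.coeff.support.max' h - f.coeff.support.min' h else 0

/-- Equal-length HS base filter banks. -/
def Base : Set Unimod := {B | B ∈ HS ∧ order (filt B 0) = order (filt B 1)}

/-- Base filter banks normalized by `B₀(1) = 1`. -/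
def NormBase : Set Unimod :=
  {B | B ∈ Base ∧ LaurentPolynomial.eval₂ (RingHom.id ℝ) (1 : ℝˣ) (filt B 0) = 1}

theorem conj_upsilon (K : ℝˣ) (S : ℝ[T;T⁻¹]) :
    gain K * upsilon (.ofAdd S) * (gain K)⁻¹ =
      upsilon (.ofAdd (((K : ℝ)⁻¹ * (K : ℝ)⁻¹) • S)) := by
  rw [mul_inv_eq_iff_eq_mul]
  apply Subtype.ext
  have h : LaurentPolynomial.C ((K : ℝ)⁻¹) * LaurentPolynomial.C (K : ℝ) = 1 := by
    rw [← map_mul]; simp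
  change !![LaurentPolynomial.C ((K : ℝ)⁻¹), 0; 0, LaurentPolynomial.C (K : ℝ)] * !![1, S; 0, 1] =
    !![1, ((K : ℝ)⁻¹ * (K : ℝ)⁻¹) • S; 0, 1] *
      !![LaurentPolynomial.C ((K : ℝ)⁻¹), 0; 0, LaurentPolynomial.C (K : ℝ)]
  simp only [LaurentPolynomial.smul_eq_C_mul, map_mul, Matrix.mul_fin_two, mul_zero, zero_mul,
    add_zero, zero_add, mul_one, one_mul]
  rw [show LaurentPolynomial.C ((K : ℝ)⁻¹) * S = LaurentPolynomial.C ((K : ℝ)⁻¹) *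
    LaurentPolynomial.C ((K : ℝ)⁻¹) * S * LaurentPolynomial.C (K : ℝ) by
      linear_combination (-LaurentPolynomial.C ((K : ℝ)⁻¹) * S) * h]

theorem conj_lambda (K : ℝˣ) (S : ℝ[T;T⁻¹]) :
    gain K * lambda (.ofAdd S) * (gain K)⁻¹ =
      lambda (.ofAdd ((K * K : ℝ) • S)) := by
  rw [mul_inv_eq_iff_eq_mul]
  apply Subtype.ext
  have h : LaurentPolynomial.C ((K : ℝ)⁻¹) * LaurentPolynomial.C (K : ℝ) = 1 := by
    rw [← map_mul]; simp
  change !![LaurentPolynomial.C ((K : ℝ)⁻¹), 0; 0, LaurentPolynomial.C (K : ℝ)] * !![1, 0; S, 1] =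
    !![1, 0; (K * K : ℝ) • S, 1] *
      !![LaurentPolynomial.C ((K : ℝ)⁻¹), 0; 0, LaurentPolynomial.C (K : ℝ)]
  simp only [LaurentPolynomial.smul_eq_C_mul, map_mul, Matrix.mul_fin_two, mul_zero, zero_mul,
    add_zero, zero_add, mul_one, one_mul]
  rw [show LaurentPolynomial.C (K : ℝ) * S = LaurentPolynomial.C (K : ℝ) *
    LaurentPolynomial.C (K : ℝ) * S * LaurentPolynomial.C ((K : ℝ)⁻¹) by
      linear_combination (-LaurentPolynomial.C (K : ℝ) * S) * h]

theorem smul_mem_WA (r : ℝ) {S : ℝ[T;T⁻¹]} (hS : S ∈ WA) : r • S ∈ WA := by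
  change LaurentPolynomial.invert (r • S) = -(r • S)
  have : LaurentPolynomial.invert S = -S := hS
  rw [map_smul, this, smul_neg]

theorem le_normalizer_of_conj {G : Type*} [Group G] (Q M : Subgroup G)
    (h : ∀ q ∈ Q, ∀ m ∈ M, q * m * q⁻¹ ∈ M) : Q ≤ Subgroup.normalizer (M : Set G) := by
  intro q hq
  rw [Subgroup.mem_normalizer_iff]
  refine fun m => ⟨fun hm => h q hq m hm, fun hm => ?_⟩
  have := h q⁻¹ (Q.inv_mem hq) _ hm
  simpa [mul_assoc] using this

theorem D_le_normalizer_U : D ≤ Subgroup.normalizer (U : Set Unimod) := by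
  refine le_normalizer_of_conj _ _ ?_
  rintro _ ⟨K, rfl⟩ _ ⟨S, hS, rfl⟩
  exact ⟨_, smul_mem_WA ((K : ℝ)⁻¹ * (K : ℝ)⁻¹) (S := S.toAdd) hS, (conj_upsilon K S.toAdd).symm⟩

theorem D_le_normalizer_L : D ≤ Subgroup.normalizer (L : Set Unimod) := by
  refine le_normalizer_of_conj _ _ ?_
  rintro _ ⟨K, rfl⟩ _ ⟨S, hS, rfl⟩
  exact ⟨_, smul_mem_WA (K * K : ℝ) (S := S.toAdd) hS, (conj_lambda K S.toAdd).symm⟩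

theorem D_le_normalizer_Cas : D ≤ Subgroup.normalizer (Cas : Set Unimod) := by
  refine le_normalizer_of_conj _ _ fun q hq m hm => ?_
  have hle : Cas ≤ Cas.comap (MulAut.conj q).toMonoidHom := by
    refine (Subgroup.closure_le _).2 ?_
    rintro x (hx | hx)
    · exact Subgroup.subset_closure
        (Or.inl ((Subgroup.mem_normalizer_iff.1 (D_le_normalizer_U hq) x).1 hx))
    · exact Subgroup.subset_closure
        (Or.inr ((Subgroup.mem_normalizer_iff.1 (D_le_normalizer_L hq) x).1 hx))
  exact hle hm

/-- The action of `𝒟` by conjugation on a subgroup `M` that it normalizes. -/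
def gamma (M : Subgroup Unimod) (h : D ≤ Subgroup.normalizer (M : Set Unimod)) :
    D →* MulAut M :=
  M.normalizerMonoidHom.comp (Subgroup.inclusion h)

/-- The letterwise action on a free product induced by actions on its two factors. -/
def coprodAct {G A B : Type*} [Group G] [Group A] [Group B] (f : G →* MulAut A)
    (g : G →* MulAut B) : G →* MulAut (Monoid.Coprod A B) where
  toFun q := MulEquiv.coprodCongr (f q) (g q)
  map_one' := by
    rw [map_one, map_one]
    exact MulEquiv.toMonoidHom_injective (Monoid.Coprod.hom_ext rfl rfl)
  map_mul' q q' := by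
    rw [map_mul, map_mul]
    exact MulEquiv.toMonoidHom_injective (Monoid.Coprod.hom_ext rfl rfl)

/-- The action `θ` of `𝒟` on the free product `𝒰 ∗ ℒ`: conjugation of each letter. -/
def theta : D →* MulAut (Monoid.Coprod U L) :=
  coprodAct (gamma U D_le_normalizer_U) (gamma L D_le_normalizer_L)

theorem U_le_Cas : U ≤ Cas := fun _ h => Subgroup.subset_closure (Or.inl h)

theorem L_le_Cas : L ≤ Cas := fun _ h => Subgroup.subset_closure (Or.inr h)

theorem D_le_Sca : D ≤ Sca := fun _ h => Subgroup.subset_closure (Or.inl h)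

theorem Cas_le_Sca : Cas ≤ Sca := fun _ h => Subgroup.subset_closure (Or.inr h)

end HSBank

end

/-!
The argument compares the degrees (highest exponents) of the two scalar filters of a bank. Lifting
the filter `Hᵢ` by a nonzero `S ∈ WA` adds `S(z²) Hⱼ` to it, and a nonzero antisymmetric `S` has
positive degree; so if `deg Hᵢ ≤ deg Hⱼ`, then afterwards `deg Hᵢ > deg Hⱼ`. Hence `𝒰` and `ℒ` play
ping-pong on the banks with unequal degrees: a nontrivial cascade never carries a bank with equal
degrees to another one. This makes `𝒞` a free product and the cosets of base banks disjoint. Gain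
scaling does not change degrees, so `𝒟` meets `𝒞` trivially and is detected by the value `H₀(1)`,
which is nonzero because the determinant equals `-2 H₀₀(1) H₁₀(1)` at `z = 1`.

Conversely, half-sample symmetry forces both degrees to be positive, and comparing leading
coefficients in `det H = 1` shows that they have the same parity. The leading term of the filter of
larger degree can therefore be cancelled by lifting with a multiple of `z^k - z^(-k)`, and iterating
this reaches a base bank. By symmetry the order of `Hᵢ` is `2 deg Hᵢ - 1`, so comparing orders is
comparing degrees.

Left cosets fail because right multiplication by a nontrivial element of `𝒰` keeps the first column
of a bank but changes the second one, while half-sample symmetry determines the second column by the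
first.
-/

noncomputable section

namespace HSBank

open LaurentPolynomial (C T invert degree degree_eq_bot_iff eval₂ eval₂_C_mul_T)

section FreeProduct

variable {G : Type*} [Group G] {A B : Subgroup G}

/-- Products `a₁ b₁ a₂ b₂ ⋯` of nontrivial elements taken alternately from `A` and `B`, the first
one (if there is any) from `A`. -/
inductive AlternatingFrom : Subgroup G → Subgroup G → G → Prop
  | one (A B : Subgroup G) : AlternatingFrom A B 1
  | mul {A B : Subgroup G} {a w : G} (ha : a ∈ A) (ha_ne : a ≠ 1) (hw : AlternatingFrom B A w) :
      AlternatingFrom A B (a * w)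

theorem AlternatingFrom.mul_left_mem {a w : G} (hw : AlternatingFrom A B w) (ha : a ∈ A) :
    AlternatingFrom A B (a * w) ∨ AlternatingFrom B A (a * w) := by
  obtain rfl | ha_ne := eq_or_ne a 1
  · exact .inl (by simpa using hw)
  cases hw with
  | one => exact .inl (.mul ha ha_ne (.one B A))
  | @mul _ _ a' w ha' _ hw =>
    rw [← mul_assoc]
    by_cases h : a * a' = 1
    · exact .inr (by simpa [h] using hw)
    · exact .inl (.mul (A.mul_mem ha ha') h hw)

theorem alternatingFrom_or_of_mem_sup {w : G} (hw : w ∈ A ⊔ B) :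
    AlternatingFrom A B w ∨ AlternatingFrom B A w := by
  have mul_left : ∀ {A B : Subgroup G} {a w : G}, a ∈ A →
      AlternatingFrom A B w ∨ AlternatingFrom B A w →
      AlternatingFrom A B (a * w) ∨ AlternatingFrom B A (a * w) := by
    rintro A B a w ha (hw | hw)
    · exact hw.mul_left_mem ha
    · obtain rfl | ha_ne := eq_or_ne a 1
      · exact .inr (by simpa using hw)
      · exact .inl (.mul ha ha_ne hw)
  rw [Subgroup.sup_eq_closure] at hw
  induction hw using Subgroup.closure_induction_left with
  | one => exact .inl (.one A B)
  | mul_left x hx y _ hy => exact hx.elim (mul_left · hy) fun hx => (mul_left hx hy.symm).symm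
  | inv_mul_cancel x hx y _ hy =>
    exact hx.elim (fun hx => mul_left (A.inv_mem hx) hy)
      fun hx => (mul_left (B.inv_mem hx) hy.symm).symm

section PingPong

variable {X : Type*} [MulAction G X] {P Q R : Set X}

theorem AlternatingFrom.eq_one_or_smul_mem {w : G} (hw : AlternatingFrom A B w)
    (hA : ∀ a ∈ A, a ≠ 1 → ∀ x ∈ Q ∪ R, a • x ∈ P) (hB : ∀ b ∈ B, b ≠ 1 → ∀ x ∈ P ∪ R, b • x ∈ Q)
    {x : X} (hx : x ∈ R) : w = 1 ∨ w • x ∈ P := by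
  induction hw generalizing P Q with
  | one => exact .inl rfl
  | mul ha ha_ne _ ih =>
    rw [mul_smul]
    obtain rfl | hwx := ih hB hA
    · exact .inr (hA _ ha ha_ne _ (.inr (by rwa [one_smul])))
    · exact .inr (hA _ ha ha_ne _ (.inl hwx))

theorem eq_one_of_mem_sup_of_smul_mem
    (hA : ∀ a ∈ A, a ≠ 1 → ∀ x ∈ Q ∪ R, a • x ∈ P) (hB : ∀ b ∈ B, b ≠ 1 → ∀ x ∈ P ∪ R, b • x ∈ Q)
    (hPR : Disjoint P R) (hQR : Disjoint Q R) {w : G} (hw : w ∈ A ⊔ B) {x : X} (hx : x ∈ R)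
    (hwx : w • x ∈ R) : w = 1 := by
  obtain hw | hw := alternatingFrom_or_of_mem_sup hw
  · exact (hw.eq_one_or_smul_mem hA hB hx).resolve_right fun h => hPR.notMem_of_mem_left h hwx
  · exact (hw.eq_one_or_smul_mem hB hA hx).resolve_right fun h => hQR.notMem_of_mem_left h hwx

theorem lift_subtype_injective_of_pingPong
    (hA : ∀ a ∈ A, a ≠ 1 → ∀ x ∈ Q ∪ R, a • x ∈ P) (hB : ∀ b ∈ B, b ≠ 1 → ∀ x ∈ P ∪ R, b • x ∈ Q)
    (hPR : Disjoint P R) (hQR : Disjoint Q R) (hR : R.Nonempty) :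
    Function.Injective (Monoid.Coprod.lift A.subtype B.subtype) := by
  obtain ⟨x, hx⟩ := hR
  let f := Monoid.Coprod.lift A.subtype B.subtype
  let _ : MulAction (Monoid.Coprod A B) X := MulAction.compHom X f
  have smul_inl (a : A) (y : X) : (Monoid.Coprod.inl a : Monoid.Coprod A B) • y = (a : G) • y := by
    change f (Monoid.Coprod.inl a) • y = _
    rw [Monoid.Coprod.lift_apply_inl, Subgroup.subtype_apply]
  have smul_inr (b : B) (y : X) : (Monoid.Coprod.inr b : Monoid.Coprod A B) • y = (b : G) • y := by
    change f (Monoid.Coprod.inr b) • y = _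
    rw [Monoid.Coprod.lift_apply_inr, Subgroup.subtype_apply]
  refine (injective_iff_map_eq_one f).2 fun w hw => ?_
  have hw_mem : w ∈ (Monoid.Coprod.inl : A →* Monoid.Coprod A B).range ⊔
      (Monoid.Coprod.inr : B →* Monoid.Coprod A B).range := by
    rw [Monoid.Coprod.range_inl_sup_range_inr]
    exact Subgroup.mem_top w
  have hwx : w • x ∈ R := by
    change f w • x ∈ R
    rwa [hw, one_smul]
  refine eq_one_of_mem_sup_of_smul_mem ?_ ?_ hPR hQR hw_mem hx hwx
  · rintro _ ⟨a, rfl⟩ ha y hy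
    exact smul_inl a y ▸ hA a a.2 (fun h => ha (by simp [OneMemClass.coe_eq_one.1 h])) y hy
  · rintro _ ⟨b, rfl⟩ hb y hy
    exact smul_inr b y ▸ hB b b.2 (fun h => hb (by simp [OneMemClass.coe_eq_one.1 h])) y hy

end PingPong

end FreeProduct

section SemidirectProduct

variable {G : Type*} [Group G] {N K : Subgroup G}

theorem monoidHomSubgroup_injective (h : K ≤ Subgroup.normalizer (N : Set G))
    (hNK : Disjoint N K) : Function.Injective (SemidirectProduct.monoidHomSubgroup h) := by
  refine (injective_iff_map_eq_one _).2 fun ⟨n, k⟩ hnk => ?_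
  obtain ⟨hn, hk⟩ := Subgroup.disjoint_iff_mul_eq_one.1 hNK n.2 k.2 hnk
  exact SemidirectProduct.ext (Subtype.ext hn) (Subtype.ext hk)

theorem range_monoidHomSubgroup (h : K ≤ Subgroup.normalizer (N : Set G)) :
    (SemidirectProduct.monoidHomSubgroup h).range = K ⊔ N := by
  refine le_antisymm ?_ (sup_le (fun k hk => ?_) fun n hn => ?_)
  · rintro _ ⟨⟨n, k⟩, rfl⟩
    exact mul_mem (Subgroup.mem_sup_right n.2) (Subgroup.mem_sup_left k.2)
  · exact ⟨.inr ⟨k, hk⟩, SemidirectProduct.lift_inr _ _ _ _⟩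
  · exact ⟨.inl ⟨n, hn⟩, SemidirectProduct.lift_inl _ _ _ _⟩

end SemidirectProduct

section Cosets

open MulOpposite (op)

variable {G : Type*} [Group G] {M : Subgroup G} {s X : Set G}

theorem eq_iUnion_op_smul (hXs : X ⊆ s) (hMs : ∀ m ∈ M, ∀ x ∈ s, m * x ∈ s)
    (hex : ∀ x ∈ s, ∃ m ∈ M, m * x ∈ X) : s = ⋃ B ∈ X, op B • (M : Set G) := by
  ext x
  simp only [Set.mem_iUnion₂, exists_prop, mem_rightCoset_iff, SetLike.mem_coe]
  constructor
  · intro hx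
    obtain ⟨m, hm, hmx⟩ := hex x hx
    exact ⟨m * x, hmx, by simpa [mul_assoc] using hm⟩
  · rintro ⟨B, hB, hxB⟩
    simpa using hMs _ hxB B (hXs hB)

theorem pairwiseDisjoint_op_smul (h : ∀ m ∈ M, ∀ B ∈ X, m * B ∈ X → m = 1) :
    X.PairwiseDisjoint fun B => op B • (M : Set G) := by
  intro B hB B' hB' hne
  refine Set.disjoint_left.2 fun x hx hx' => hne ?_
  rw [mem_rightCoset_iff] at hx hx'
  have hBB' : B' * B⁻¹ ∈ M := by simpa [mul_assoc] using M.mul_mem (M.inv_mem hx') hx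
  exact (mul_inv_eq_one.1 (h _ hBB' B hB (by simpa using hB'))).symm

theorem mul_mem_of_eq_iUnion_smul (hs : s = ⋃ A ∈ X, A • (M : Set G)) {x m : G} (hx : x ∈ s)
    (hm : m ∈ M) : x * m ∈ s := by
  subst hs
  simp only [Set.mem_iUnion₂, mem_leftCoset_iff, SetLike.mem_coe] at hx ⊢
  obtain ⟨A, hA, hxA⟩ := hx
  exact ⟨A, hA, by simpa [mul_assoc] using M.mul_mem hxA hm⟩

end Cosets

section Degree

variable {R : Type*} [Semiring R] {f g : R[T;T⁻¹]} {m n : ℤ}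

theorem degree_le_coe_iff : degree f ≤ m ↔ ∀ k, m < k → f.coeff k = 0 := by
  simp only [degree, Finset.max_le_iff, Finsupp.mem_support_iff, WithBot.coe_le_coe]
  exact forall_congr' fun k => by rw [← not_lt, not_imp_not]

theorem degree_lt_coe_iff : degree f < m ↔ ∀ k, m ≤ k → f.coeff k = 0 := by
  rw [degree, Finset.max_eq_sup_withBot, Finset.sup_lt_iff (WithBot.bot_lt_coe m)]
  simp only [Finsupp.mem_support_iff, WithBot.coe_lt_coe]
  exact forall_congr' fun k => by rw [← not_le, not_imp_not]

theorem degree_eq_coe_iff : degree f = m ↔ f.coeff m ≠ 0 ∧ ∀ k, m < k → f.coeff k = 0 :=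
  ⟨fun h => ⟨Finsupp.mem_support_iff.1 (Finset.mem_of_max h), degree_le_coe_iff.1 h.le⟩,
    fun ⟨hm, hlt⟩ => (degree_le_coe_iff.2 hlt).antisymm
      (Finset.le_max (Finsupp.mem_support_iff.2 hm))⟩

theorem exists_degree_eq_coe (hf : f ≠ 0) : ∃ m : ℤ, degree f = m :=
  (WithBot.ne_bot_iff_exists.1 (degree_eq_bot_iff.not.2 hf)).imp fun _ h => h.symm

theorem degree_add_eq_right_of_degree_lt (h : degree f < degree g) : degree (f + g) = degree g := by
  simp only [degree, Finset.max_eq_sup_withBot] at h ⊢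
  exact AddMonoidAlgebra.supDegree_add_eq_right h

theorem coeff_mul_add_of_degree_le (hf : degree f ≤ m) (hg : degree g ≤ n) :
    (f * g).coeff (m + n) = f.coeff m * g.coeff n := by
  rw [degree_le_coe_iff] at hf hg
  rw [AddMonoidAlgebra.coeff_mul_apply_left, Finsupp.sum, Finset.sum_eq_single m]
  · rw [neg_add_cancel_left]
  · intro k hk hkm
    have hlt : k < m := lt_of_le_of_ne (not_lt.1 fun h => Finsupp.mem_support_iff.1 hk (hf k h)) hkm
    rw [hg _ (by omega), mul_zero]
  · intro hm
    rw [Finsupp.notMem_support_iff.1 hm, zero_mul]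

theorem degree_mul [NoZeroDivisors R] (f g : R[T;T⁻¹]) : degree (f * g) = degree f + degree g := by
  obtain rfl | hf := eq_or_ne f 0
  · simp
  obtain rfl | hg := eq_or_ne g 0
  · simp
  obtain ⟨m, hm⟩ := exists_degree_eq_coe hf
  obtain ⟨n, hn⟩ := exists_degree_eq_coe hg
  rw [hm, hn, ← WithBot.coe_add, degree_eq_coe_iff]
  refine ⟨?_, fun k hk => ?_⟩
  · rw [coeff_mul_add_of_degree_le hm.le hn.le]
    exact mul_ne_zero (degree_eq_coe_iff.1 hm).1 (degree_eq_coe_iff.1 hn).1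
  · have hlt : degree f < ↑(k - n) := by rw [hm, WithBot.coe_lt_coe]; omega
    rw [← sub_add_cancel k n, coeff_mul_add_of_degree_le hlt.le hn.le,
      degree_lt_coe_iff.1 hlt _ le_rfl, zero_mul]

theorem degree_smul [NoZeroDivisors R] {r : R} (hr : r ≠ 0) (f : R[T;T⁻¹]) :
    degree (r • f) = degree f := by
  rw [LaurentPolynomial.smul_eq_C_mul, degree_mul, LaurentPolynomial.degree_C hr, zero_add]

theorem coeff_T_mul (f : R[T;T⁻¹]) (k n : ℤ) : (T k * f).coeff n = f.coeff (n - k) := by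
  rw [T, AddMonoidAlgebra.coeff_single_mul_apply, one_mul, neg_add_eq_sub]

theorem le_two_mul_of_degree_eq {c : ℤ} (hsymm : ∀ k, f.coeff (c - k) = 0 → f.coeff k = 0)
    (hm : degree f = m) : c ≤ 2 * m := by
  obtain ⟨hm_ne, hlt⟩ := degree_eq_coe_iff.1 hm
  by_contra! h
  exact hm_ne (hsymm m (hlt _ (by omega)))

theorem order_eq_of_degree_eq {f : ℝ[T;T⁻¹]} {c : ℤ}
    (hsymm : ∀ k, f.coeff (c - k) = 0 → f.coeff k = 0) (hm : degree f = m) :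
    order f = 2 * m - c := by
  obtain ⟨hm_ne, hlt⟩ := degree_eq_coe_iff.1 hm
  have hle : ∀ k ∈ f.coeff.support, k ≤ m := fun k hk =>
    not_lt.1 fun h => Finsupp.mem_support_iff.1 hk (hlt k h)
  have hm_mem : m ∈ f.coeff.support := Finsupp.mem_support_iff.2 hm_ne
  have hc_mem : ∀ k ∈ f.coeff.support, c - k ∈ f.coeff.support := fun k hk =>
    Finsupp.mem_support_iff.2 fun h => Finsupp.mem_support_iff.1 hk (hsymm k h)
  have hne : f.coeff.support.Nonempty := ⟨m, hm_mem⟩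
  have hmax : f.coeff.support.max' hne = m :=
    (Finset.max'_eq_iff _ _ _).2 ⟨hm_mem, hle⟩
  have hmin : f.coeff.support.min' hne = c - m :=
    (Finset.min'_eq_iff _ _ _).2 ⟨hc_mem m hm_mem, fun k hk => by linarith [hle _ (hc_mem k hk)]⟩
  rw [order, dif_pos hne, hmax, hmin]
  ring

end Degree

theorem eval₂_invert {R S : Type*} [CommSemiring R] [CommSemiring S] (φ : R →+* S) (x : Sˣ)
    (f : R[T;T⁻¹]) : eval₂ φ x (invert f) = eval₂ φ x⁻¹ f := by
  induction f using LaurentPolynomial.induction_on' with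
  | add p q hp hq => rw [map_add, map_add, map_add, hp, hq]
  | C_mul_T n c =>
    rw [map_mul, LaurentPolynomial.invert_C, LaurentPolynomial.invert_T, eval₂_C_mul_T,
      eval₂_C_mul_T, inv_zpow', zpow_neg]

section SubstSq

theorem substSq_C_mul_T (c : ℝ) (n : ℤ) : substSq (C c * T n) = C c * T (2 * n) := by
  rw [← LaurentPolynomial.single_eq_C_mul_T, ← LaurentPolynomial.single_eq_C_mul_T]
  exact AddMonoidAlgebra.mapDomain_single

theorem substSq_C (c : ℝ) : substSq (C c) = C c := by
  simpa using substSq_C_mul_T c 0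

theorem substSq_T (n : ℤ) : substSq (T n) = T (2 * n) := by
  simpa using substSq_C_mul_T 1 n

theorem coeff_substSq_two_mul (f : ℝ[T;T⁻¹]) (k : ℤ) : (substSq f).coeff (2 * k) = f.coeff k :=
  Finsupp.mapDomain_apply (mul_right_injective₀ two_ne_zero) f.coeff k

theorem coeff_substSq_two_mul_add_one (f : ℝ[T;T⁻¹]) (k : ℤ) :
    (substSq f).coeff (2 * k + 1) = 0 := by
  refine Finsupp.mapDomain_of_notMem_range f.coeff _ ?_
  rintro ⟨n, hn : 2 * n = 2 * k + 1⟩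
  omega

theorem degree_substSq_eq_coe {f : ℝ[T;T⁻¹]} {m : ℤ} (hm : degree f = m) :
    degree (substSq f) = (2 * m : ℤ) := by
  obtain ⟨hm_ne, hlt⟩ := degree_eq_coe_iff.1 hm
  refine degree_eq_coe_iff.2 ⟨by rwa [coeff_substSq_two_mul], fun n hn => ?_⟩
  obtain ⟨k, rfl | rfl⟩ := Int.even_or_odd' n
  · rw [coeff_substSq_two_mul, hlt k (by omega)]
  · exact coeff_substSq_two_mul_add_one f k

theorem eval₂_substSq (x : ℝˣ) (f : ℝ[T;T⁻¹]) :
    eval₂ (RingHom.id ℝ) x (substSq f) = eval₂ (RingHom.id ℝ) (x ^ 2) f := by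
  induction f using LaurentPolynomial.induction_on' with
  | add p q hp hq => rw [map_add, map_add, map_add, hp, hq]
  | C_mul_T n c =>
    rw [substSq_C_mul_T, eval₂_C_mul_T, eval₂_C_mul_T, zpow_mul, zpow_ofNat]

end SubstSq

section WA

theorem mem_WA_iff {S : ℝ[T;T⁻¹]} : S ∈ WA ↔ invert S = -S := Iff.rfl

theorem coeff_neg_of_mem_WA {S : ℝ[T;T⁻¹]} (hS : S ∈ WA) (n : ℤ) :
    S.coeff (-n) = -S.coeff n := by
  rw [← LaurentPolynomial.invert_apply, mem_WA_iff.1 hS, AddMonoidAlgebra.coeff_neg,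
    Finsupp.neg_apply]

theorem pos_of_mem_WA_of_degree_eq {S : ℝ[T;T⁻¹]} {m : ℤ} (hS : S ∈ WA) (hm : degree S = m) :
    0 < m := by
  have hnonneg : 0 ≤ 2 * m := le_two_mul_of_degree_eq
    (fun k hk => by rwa [zero_sub, coeff_neg_of_mem_WA hS, neg_eq_zero] at hk) hm
  have hcoeff_zero : S.coeff 0 = 0 := self_eq_neg.1 (by simpa using coeff_neg_of_mem_WA hS 0)
  have hne : m ≠ 0 := by
    rintro rfl
    exact (degree_eq_coe_iff.1 hm).1 hcoeff_zero
  omega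

theorem C_mul_T_sub_T_mem_WA (c : ℝ) (k : ℤ) : C c * (T k - T (-k)) ∈ WA := by
  simp only [mem_WA_iff, map_mul, map_sub, LaurentPolynomial.invert_C, LaurentPolynomial.invert_T,
    neg_neg, ← mul_neg, neg_sub]

theorem exists_mem_WA_degree_add_lt {f g : ℝ[T;T⁻¹]} {k n : ℤ} (hf : degree f = (2 * k + n : ℤ))
    (hg : degree g = n) (hk : 0 < k) : ∃ S ∈ WA, degree (f + substSq S * g) < degree f := by
  obtain ⟨hg_ne, hg_lt⟩ := degree_eq_coe_iff.1 hg
  let c := -(f.coeff (2 * k + n) / g.coeff n)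
  have hcoeff (j : ℤ) : (f + substSq (C c * (T k - T (-k))) * g).coeff j =
      f.coeff j + c * (g.coeff (j - 2 * k) - g.coeff (j + 2 * k)) := by
    rw [map_mul, map_sub, substSq_C, substSq_T, substSq_T, mul_assoc, sub_mul,
      ← LaurentPolynomial.smul_eq_C_mul, AddMonoidAlgebra.coeff_add, Finsupp.add_apply,
      AddMonoidAlgebra.coeff_smul_apply, AddMonoidAlgebra.coeff_sub, Finsupp.sub_apply,
      coeff_T_mul, coeff_T_mul, smul_eq_mul, mul_neg, sub_neg_eq_add]
  refine ⟨_, C_mul_T_sub_T_mem_WA c k, ?_⟩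
  rw [hf, degree_lt_coe_iff]
  intro j hj
  rw [hcoeff, hg_lt (j + 2 * k) (by omega), sub_zero]
  obtain rfl | hj := hj.eq_or_lt
  · rw [add_sub_cancel_left, neg_mul, div_mul_cancel₀ _ hg_ne, add_neg_cancel]
  · rw [(degree_eq_coe_iff.1 hf).2 j hj, hg_lt (j - 2 * k) (by omega), mul_zero, add_zero]

end WA

section Filters

variable {H : Unimod} {i j : Fin 2}

theorem det_eq_C (hij : i ≠ j) (H : Unimod) :
    H.1 i 0 * H.1 j 1 - H.1 i 1 * H.1 j 0 = C ((-1) ^ (i : ℕ)) := by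
  have hdet : H.1 0 0 * H.1 1 1 - H.1 0 1 * H.1 1 0 = 1 := by
    rw [← Matrix.det_fin_two]
    exact H.2
  fin_cases i <;> fin_cases j
  · exact absurd rfl hij
  · simpa using hdet
  · simpa using by linear_combination -hdet
  · exact absurd rfl hij

theorem coeff_filt_two_mul (H : Unimod) (i : Fin 2) (k : ℤ) :
    (filt H i).coeff (2 * k) = (H.1 i 0).coeff k := by
  rw [filt, AddMonoidAlgebra.coeff_add, Finsupp.add_apply, coeff_substSq_two_mul, coeff_T_mul,
    show 2 * k - 1 = 2 * (k - 1) + 1 by ring, coeff_substSq_two_mul_add_one, add_zero]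

theorem coeff_filt_two_mul_add_one (H : Unimod) (i : Fin 2) (k : ℤ) :
    (filt H i).coeff (2 * k + 1) = (H.1 i 1).coeff k := by
  rw [filt, AddMonoidAlgebra.coeff_add, Finsupp.add_apply, coeff_substSq_two_mul_add_one,
    coeff_T_mul, add_sub_cancel_right, coeff_substSq_two_mul, zero_add]

theorem filt_ne_zero (H : Unimod) (i : Fin 2) : filt H i ≠ 0 := by
  intro hzero
  obtain ⟨j, hij⟩ := exists_ne i
  have hi0 : H.1 i 0 = 0 := by
    ext k
    rw [← coeff_filt_two_mul, hzero]
    rfl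
  have hi1 : H.1 i 1 = 0 := by
    ext k
    rw [← coeff_filt_two_mul_add_one, hzero]
    rfl
  have hdet := det_eq_C hij.symm H
  rw [hi0, hi1, zero_mul, zero_mul, sub_zero] at hdet
  exact (map_ne_zero C).2 (pow_ne_zero _ (neg_ne_zero.2 one_ne_zero)) hdet.symm

theorem add_eq_one_of_degree_filt_even_odd (hij : i ≠ j) {m n : ℤ} (hm : degree (filt H i) = m)
    (hn : degree (filt H j) = n) (hm_even : Even m) (hn_odd : Odd n) : m + n = 1 := by
  obtain ⟨p, rfl⟩ := even_iff_two_dvd.1 hm_even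
  obtain ⟨q, rfl⟩ := hn_odd
  obtain ⟨hm_ne, hm_lt⟩ := degree_eq_coe_iff.1 hm
  obtain ⟨hn_ne, hn_lt⟩ := degree_eq_coe_iff.1 hn
  rw [coeff_filt_two_mul] at hm_ne
  rw [coeff_filt_two_mul_add_one] at hn_ne
  have hi0 : degree (H.1 i 0) ≤ p := degree_le_coe_iff.2 fun k hk => by
    rw [← coeff_filt_two_mul, hm_lt _ (by omega)]
  have hi1 : degree (H.1 i 1) < p := degree_lt_coe_iff.2 fun k hk => by
    rw [← coeff_filt_two_mul_add_one, hm_lt _ (by omega)]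
  have hj0 : degree (H.1 j 0) ≤ q := degree_le_coe_iff.2 fun k hk => by
    rw [← coeff_filt_two_mul, hn_lt _ (by omega)]
  have hj1 : degree (H.1 j 1) ≤ q := degree_le_coe_iff.2 fun k hk => by
    rw [← coeff_filt_two_mul_add_one, hn_lt _ (by omega)]
  -- Only the two leading coefficients contribute to this coefficient of the constant determinant.
  have hcoeff : (H.1 i 0 * H.1 j 1 - H.1 i 1 * H.1 j 0).coeff (p + q) ≠ 0 := by
    rw [AddMonoidAlgebra.coeff_sub, Finsupp.sub_apply, coeff_mul_add_of_degree_le hi0 hj1,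
      coeff_mul_add_of_degree_le hi1.le hj0, degree_lt_coe_iff.1 hi1 p le_rfl, zero_mul, sub_zero]
    exact mul_ne_zero hm_ne hn_ne
  rw [det_eq_C hij, LaurentPolynomial.C_apply, ite_ne_right_iff] at hcoeff
  omega

end Filters

section Lifting

variable {i j : Fin 2}

theorem coe_upsilon (S : ℝ[T;T⁻¹]) : (upsilon (.ofAdd S)).1 = !![1, S; 0, 1] := rfl

theorem coe_lambda (S : ℝ[T;T⁻¹]) : (lambda (.ofAdd S)).1 = !![1, 0; S, 1] := rfl

theorem coe_gain (K : ℝˣ) : (gain K).1 = !![C (K : ℝ)⁻¹, 0; 0, C (K : ℝ)] := rfl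

/-- The lifting matrices, indexed by the row that they modify: `lifting 0 = upsilon` and
`lifting 1 = lambda`. It allows the two kinds of lifting steps to be treated alike. -/
def lifting : Fin 2 → Multiplicative ℝ[T;T⁻¹] →* Unimod := ![upsilon, lambda]

theorem lifting_mul_apply_self (hij : i ≠ j) (S : ℝ[T;T⁻¹]) (H : Unimod) (k : Fin 2) :
    (lifting i (.ofAdd S) * H).1 i k = H.1 i k + S * H.1 j k := by
  rw [Matrix.SpecialLinearGroup.coe_mul, Matrix.mul_apply, Fin.sum_univ_two]
  fin_cases i <;> fin_cases j <;> simp [lifting, coe_upsilon, coe_lambda, add_comm] at hij ⊢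

theorem lifting_mul_apply_of_ne (hij : i ≠ j) (S : ℝ[T;T⁻¹]) (H : Unimod) (k : Fin 2) :
    (lifting i (.ofAdd S) * H).1 j k = H.1 j k := by
  rw [Matrix.SpecialLinearGroup.coe_mul, Matrix.mul_apply, Fin.sum_univ_two]
  fin_cases i <;> fin_cases j <;> simp [lifting, coe_upsilon, coe_lambda] at hij ⊢

theorem filt_lifting_mul_self (hij : i ≠ j) (S : ℝ[T;T⁻¹]) (H : Unimod) :
    filt (lifting i (.ofAdd S) * H) i = filt H i + substSq S * filt H j := by
  simp only [filt, lifting_mul_apply_self hij, map_add, map_mul]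
  ring

theorem filt_lifting_mul_of_ne (hij : i ≠ j) (S : ℝ[T;T⁻¹]) (H : Unimod) :
    filt (lifting i (.ofAdd S) * H) j = filt H j := by
  simp only [filt, lifting_mul_apply_of_ne hij]

theorem degree_filt_lifting_mul_lt (hij : i ≠ j) {S : ℝ[T;T⁻¹]} (hS : S ∈ WA) (hS_ne : S ≠ 0)
    {H : Unimod} (h : degree (filt H i) ≤ degree (filt H j)) :
    degree (filt (lifting i (.ofAdd S) * H) j) < degree (filt (lifting i (.ofAdd S) * H) i) := by
  obtain ⟨k, hk⟩ := exists_degree_eq_coe hS_ne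
  obtain ⟨n, hn⟩ := exists_degree_eq_coe (filt_ne_zero H j)
  have hk_pos : 0 < k := pos_of_mem_WA_of_degree_eq hS hk
  have hgrow : degree (filt H j) < degree (substSq S * filt H j) := by
    rw [degree_mul, degree_substSq_eq_coe hk, hn, ← WithBot.coe_add, WithBot.coe_lt_coe]
    omega
  rwa [filt_lifting_mul_self hij, filt_lifting_mul_of_ne hij,
    degree_add_eq_right_of_degree_lt (h.trans_lt hgrow)]

theorem degree_filt_mul_lt_of_mem_map_lifting (hij : i ≠ j) {a : Unimod}
    (ha : a ∈ (AddSubgroup.toSubgroup WA).map (lifting i)) (ha_ne : a ≠ 1) {H : Unimod}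
    (hH : degree (filt H i) ≤ degree (filt H j)) :
    degree (filt (a * H) j) < degree (filt (a * H) i) := by
  obtain ⟨S, hS, rfl⟩ := ha
  exact degree_filt_lifting_mul_lt hij hS (fun h : S = 1 => ha_ne (by rw [h, map_one])) hH

theorem gain_mul_apply (K : ℝˣ) (H : Unimod) (i k : Fin 2) :
    (gain K * H).1 i k = C ((![K⁻¹, K] i : ℝˣ) : ℝ) * H.1 i k := by
  rw [Matrix.SpecialLinearGroup.coe_mul, Matrix.mul_apply, Fin.sum_univ_two]
  fin_cases i <;> simp [coe_gain]

theorem filt_gain_mul (K : ℝˣ) (H : Unimod) (i : Fin 2) :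
    filt (gain K * H) i = ((![K⁻¹, K] i : ℝˣ) : ℝ) • filt H i := by
  simp only [filt, gain_mul_apply, map_mul, substSq_C, LaurentPolynomial.smul_eq_C_mul]
  ring

theorem degree_filt_gain_mul (K : ℝˣ) (H : Unimod) (i : Fin 2) :
    degree (filt (gain K * H) i) = degree (filt H i) := by
  rw [filt_gain_mul, degree_smul (Units.ne_zero _)]

end Lifting

section HalfSampleSymmetric

variable {H : Unimod} {i j : Fin 2}

theorem mem_HS_iff : H ∈ HS ↔ ∀ i, invert (H.1 i 0) = (-1) ^ (i : ℕ) * H.1 i 1 := by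
  have hentries : H ∈ HS ↔ (invert (H.1 0 0) = H.1 0 1 ∧ invert (H.1 0 1) = H.1 0 0) ∧
      invert (H.1 1 0) = -H.1 1 1 ∧ invert (H.1 1 1) = -H.1 1 0 := by
    change H.1.map invert = !![1, 0; 0, -1] * H.1 * !![0, 1; 1, 0] ↔ _
    rw [Matrix.eta_fin_two H.1]
    simp [← Matrix.ext_iff, Fin.forall_fin_two]
  have hrow_zero (h : invert (H.1 0 0) = H.1 0 1) : invert (H.1 0 1) = H.1 0 0 := by
    rw [← h, LaurentPolynomial.involutive_invert]
  have hrow_one (h : invert (H.1 1 0) = -H.1 1 1) : invert (H.1 1 1) = -H.1 1 0 := by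
    rw [← neg_neg (H.1 1 1), ← h, map_neg, LaurentPolynomial.involutive_invert]
  rw [hentries, and_iff_left_of_imp hrow_zero, and_iff_left_of_imp hrow_one, Fin.forall_fin_two]
  simp

theorem coeff_filt_one_sub (hH : H ∈ HS) (i : Fin 2) (n : ℤ) :
    (filt H i).coeff (1 - n) = (-1) ^ (i : ℕ) * (filt H i).coeff n := by
  have hcoeff (k : ℤ) : (H.1 i 0).coeff (-k) = (-1) ^ (i : ℕ) * (H.1 i 1).coeff k := by
    rw [← LaurentPolynomial.invert_apply, mem_HS_iff.1 hH]
    fin_cases i <;> simp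
  obtain ⟨k, rfl | rfl⟩ := Int.even_or_odd' n
  · rw [show 1 - 2 * k = 2 * -k + 1 by ring, coeff_filt_two_mul_add_one, coeff_filt_two_mul,
      ← neg_neg k, hcoeff, ← mul_assoc, ← mul_pow, neg_neg]
    simp
  · rw [show 1 - (2 * k + 1) = 2 * -k by ring, coeff_filt_two_mul_add_one, coeff_filt_two_mul,
      hcoeff]

theorem exists_degree_filt_eq (hH : H ∈ HS) (i : Fin 2) :
    ∃ m : ℤ, 0 < m ∧ degree (filt H i) = m ∧ order (filt H i) = 2 * m - 1 := by
  obtain ⟨m, hm⟩ := exists_degree_eq_coe (filt_ne_zero H i)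
  have hsymm (k : ℤ) (hk : (filt H i).coeff (1 - k) = 0) : (filt H i).coeff k = 0 := by
    rw [coeff_filt_one_sub hH] at hk
    exact (mul_eq_zero.1 hk).resolve_left (pow_ne_zero _ (neg_ne_zero.2 one_ne_zero))
  have hle : 1 ≤ 2 * m := le_two_mul_of_degree_eq hsymm hm
  exact ⟨m, by omega, hm, order_eq_of_degree_eq hsymm hm⟩

theorem order_filt_pos (hH : H ∈ HS) (i : Fin 2) : 0 < order (filt H i) := by
  obtain ⟨m, hm, -, hm_order⟩ := exists_degree_filt_eq hH i
  omega

theorem order_filt_lt_iff {H' : Unimod} (hH : H ∈ HS) (hH' : H' ∈ HS) :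
    order (filt H i) < order (filt H' j) ↔ degree (filt H i) < degree (filt H' j) := by
  obtain ⟨m, -, hm, hm_order⟩ := exists_degree_filt_eq hH i
  obtain ⟨n, -, hn, hn_order⟩ := exists_degree_filt_eq hH' j
  rw [hm, hn, hm_order, hn_order, WithBot.coe_lt_coe]
  omega

theorem mem_Base_iff : H ∈ Base ↔ H ∈ HS ∧ degree (filt H 0) = degree (filt H 1) := by
  refine and_congr_right fun hH => ?_
  rw [← not_iff_not, ← Ne, ← Ne, ne_iff_lt_or_gt, ne_iff_lt_or_gt, order_filt_lt_iff hH hH,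
    order_filt_lt_iff hH hH]

theorem even_add_of_degree_filt_eq (hH : H ∈ HS) (hij : i ≠ j) {m n : ℤ}
    (hm : degree (filt H i) = m) (hn : degree (filt H j) = n) : Even (m + n) := by
  obtain ⟨m', hm_pos, hm', -⟩ := exists_degree_filt_eq hH i
  obtain ⟨n', hn_pos, hn', -⟩ := exists_degree_filt_eq hH j
  obtain rfl : m' = m := WithBot.coe_injective (hm'.symm.trans hm)
  obtain rfl : n' = n := WithBot.coe_injective (hn'.symm.trans hn)
  obtain hm_even | hm_odd := Int.even_or_odd m' <;> obtain hn_even | hn_odd := Int.even_or_odd n'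
  · exact hm_even.add hn_even
  · have := add_eq_one_of_degree_filt_even_odd hij hm hn hm_even hn_odd
    omega
  · have := add_eq_one_of_degree_filt_even_odd hij.symm hn hm hn_even hm_odd
    omega
  · exact hm_odd.add_odd hn_odd

theorem lifting_mul_mem_HS (i : Fin 2) {S : ℝ[T;T⁻¹]} (hS : S ∈ WA) (hH : H ∈ HS) :
    lifting i (.ofAdd S) * H ∈ HS := by
  rw [mem_HS_iff] at hH ⊢
  obtain ⟨j, hij⟩ := exists_ne i
  intro k
  obtain rfl | hk := eq_or_ne k i
  · rw [lifting_mul_apply_self hij.symm, lifting_mul_apply_self hij.symm, map_add, map_mul, hH, hH,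
      mem_WA_iff.1 hS]
    have hsign : (-1 : ℝ[T;T⁻¹]) ^ (j : ℕ) = -(-1) ^ (k : ℕ) := by
      fin_cases k <;> fin_cases j <;> simp at hij ⊢
    rw [hsign]
    ring
  · rw [lifting_mul_apply_of_ne hk.symm, lifting_mul_apply_of_ne hk.symm, hH]

theorem gain_mul_mem_HS (K : ℝˣ) (hH : H ∈ HS) : gain K * H ∈ HS := by
  rw [mem_HS_iff] at hH ⊢
  intro i
  rw [gain_mul_apply, gain_mul_apply, map_mul, hH, LaurentPolynomial.invert_C, mul_left_comm]

theorem Sca_le_stabilizer_HS : Sca ≤ MulAction.stabilizer Unimod HS := by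
  have hlifting (i : Fin 2) :
      (AddSubgroup.toSubgroup WA).map (lifting i) ≤ MulAction.stabilizer Unimod HS := by
    rw [MulAction.le_stabilizer_iff_smul_le]
    rintro _ ⟨S, hS, rfl⟩ _ ⟨H, hH, rfl⟩
    exact lifting_mul_mem_HS i hS hH
  have hgain : D ≤ MulAction.stabilizer Unimod HS := by
    rw [MulAction.le_stabilizer_iff_smul_le]
    rintro _ ⟨K, rfl⟩ _ ⟨H, hH, rfl⟩
    exact gain_mul_mem_HS K hH
  refine (Subgroup.closure_le _).2 (Set.union_subset hgain ?_)
  exact (Subgroup.closure_le _).2 (Set.union_subset (hlifting 0) (hlifting 1))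

theorem mul_mem_HS {s : Unimod} (hs : s ∈ Sca) (hH : H ∈ HS) : s * H ∈ HS := by
  rw [← MulAction.mem_stabilizer_iff.1 (Sca_le_stabilizer_HS hs)]
  exact Set.smul_mem_smul_set hH

end HalfSampleSymmetric

section RightCosets

variable {H : Unimod} {i j : Fin 2}

theorem lifting_mem_Cas (i : Fin 2) {S : ℝ[T;T⁻¹]} (hS : S ∈ WA) : lifting i (.ofAdd S) ∈ Cas := by
  fin_cases i
  · exact U_le_Cas ⟨.ofAdd S, hS, rfl⟩
  · exact L_le_Cas ⟨.ofAdd S, hS, rfl⟩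

theorem exists_degree_filt_lifting_mul_lt (hH : H ∈ HS) (hij : i ≠ j)
    (h : degree (filt H j) < degree (filt H i)) :
    ∃ S ∈ WA, degree (filt (lifting i (.ofAdd S) * H) i) < degree (filt H i) := by
  obtain ⟨m, hm⟩ := exists_degree_eq_coe (filt_ne_zero H i)
  obtain ⟨n, hn⟩ := exists_degree_eq_coe (filt_ne_zero H j)
  have hnm : n < m := by rwa [hm, hn, WithBot.coe_lt_coe] at h
  obtain ⟨k, hk⟩ := Int.even_sub.2 (Int.even_add.1 (even_add_of_degree_filt_eq hH hij hm hn))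
  obtain rfl : m = 2 * k + n := by omega
  obtain ⟨S, hS, hlt⟩ := exists_mem_WA_degree_add_lt hm hn (by omega)
  exact ⟨S, hS, by rwa [filt_lifting_mul_self hij]⟩

theorem exists_sum_order_filt_lt (hH : H ∈ HS) (h : degree (filt H 0) ≠ degree (filt H 1)) :
    ∃ c ∈ Cas, ∑ k, order (filt (c * H) k) < ∑ k, order (filt H k) := by
  obtain ⟨i, j, hij, hlt⟩ : ∃ i j, i ≠ j ∧ degree (filt H j) < degree (filt H i) :=
    h.lt_or_gt.elim (fun h => ⟨1, 0, one_ne_zero, h⟩) fun h => ⟨0, 1, zero_ne_one, h⟩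
  obtain ⟨S, hS, hdegree⟩ := exists_degree_filt_lifting_mul_lt hH hij hlt
  have horder : order (filt (lifting i (.ofAdd S) * H) i) < order (filt H i) :=
    (order_filt_lt_iff (lifting_mul_mem_HS i hS hH) hH).2 hdegree
  refine ⟨_, lifting_mem_Cas i hS, Finset.sum_lt_sum (fun k _ => ?_) ⟨i, Finset.mem_univ i, horder⟩⟩
  obtain rfl | hk := eq_or_ne k i
  · exact horder.le
  · rw [filt_lifting_mul_of_ne hk.symm]

theorem exists_mem_Cas_mul_mem_Base (hH : H ∈ HS) : ∃ c ∈ Cas, c * H ∈ Base := by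
  induction hN : (∑ k, order (filt H k)).toNat using Nat.strong_induction_on generalizing H with
  | _ N ih =>
    by_cases hdegree : degree (filt H 0) = degree (filt H 1)
    · exact ⟨1, Cas.one_mem, by rwa [one_mul, mem_Base_iff, and_iff_right hH]⟩
    obtain ⟨c, hc, hlt⟩ := exists_sum_order_filt_lt hH hdegree
    have hpos : 0 < ∑ k, order (filt H k) :=
      Finset.sum_pos (fun k _ => order_filt_pos hH k) Finset.univ_nonempty
    obtain ⟨c', hc', hBase⟩ :=
      ih _ (hN ▸ (Int.toNat_lt_toNat hpos).2 hlt) (mul_mem_HS (Cas_le_Sca hc) hH) rfl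
    exact ⟨c' * c, Cas.mul_mem hc' hc, by rwa [mul_assoc]⟩

/-- The filter banks whose `i`-th filter has larger degree than the `j`-th one. For `(i, j)` equal
to `(0, 1)` and `(1, 0)` these are the two sides of the ping-pong game played by `U` and `L`. -/
def degreeGT (i j : Fin 2) : Set Unimod := {H | degree (filt H j) < degree (filt H i)}

/-- The filter banks with filters of equal degrees, where the ping-pong game of `U` and `L`
starts. -/
def degreeEq : Set Unimod := {H | degree (filt H 0) = degree (filt H 1)}

theorem Base_eq_inter : Base = HS ∩ degreeEq := Set.ext fun _ => mem_Base_iff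

/-- The normalized Haar filter bank, with filters `(1 + z) / 2` and `z - 1`. It witnesses that the
HS class is nonempty. -/
def haar : Unimod :=
  ⟨!![C (1 / 2), C (1 / 2); -1, 1], by
    rw [Matrix.det_fin_two_of, mul_one, mul_neg_one, sub_neg_eq_add, ← map_add, add_halves,
      map_one]⟩

theorem haar_mem_HS : haar ∈ HS := by
  refine mem_HS_iff.2 fun i => ?_
  fin_cases i <;> simp [haar]

theorem degreeEq_nonempty : degreeEq.Nonempty := by
  obtain ⟨c, -, hBase⟩ := exists_mem_Cas_mul_mem_Base haar_mem_HS
  exact ⟨_, (mem_Base_iff.1 hBase).2⟩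

theorem disjoint_degreeGT_degreeEq (hij : i ≠ j) : Disjoint (degreeGT i j) degreeEq := by
  refine Set.disjoint_left.2 fun H hlt heq => ?_
  have hlt : degree (filt H j) < degree (filt H i) := hlt
  have heq : degree (filt H 0) = degree (filt H 1) := heq
  fin_cases i <;> fin_cases j <;> simp [heq] at hij hlt

theorem smul_mem_degreeGT (hij : i ≠ j) :
    ∀ a ∈ (AddSubgroup.toSubgroup WA).map (lifting i), a ≠ 1 →
      ∀ H ∈ degreeGT j i ∪ degreeEq, a • H ∈ degreeGT i j := by
  intro a ha ha_ne H hH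
  refine degree_filt_mul_lt_of_mem_map_lifting hij ha ha_ne ?_
  obtain hlt | heq := hH
  · exact le_of_lt hlt
  · have heq : degree (filt H 0) = degree (filt H 1) := heq
    fin_cases i <;> fin_cases j <;> simp [heq]

theorem eq_one_of_mem_Cas_of_mul_mem_degreeEq {c : Unimod} (hc : c ∈ Cas) (hH : H ∈ degreeEq)
    (hcH : c * H ∈ degreeEq) : c = 1 := by
  rw [Cas, ← Subgroup.sup_eq_closure] at hc
  exact eq_one_of_mem_sup_of_smul_mem (smul_mem_degreeGT zero_ne_one)
    (smul_mem_degreeGT one_ne_zero) (disjoint_degreeGT_degreeEq zero_ne_one)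
    (disjoint_degreeGT_degreeEq one_ne_zero) hc hH hcH

theorem gain_mul_mem_degreeEq (K : ℝˣ) (hH : H ∈ degreeEq) : gain K * H ∈ degreeEq := by
  change degree _ = degree _
  rwa [degree_filt_gain_mul, degree_filt_gain_mul]

end RightCosets

section Normalization

variable {H : Unimod}

theorem disjoint_Cas_D : Disjoint Cas D := by
  obtain ⟨B, hB⟩ := degreeEq_nonempty
  refine Subgroup.disjoint_def.2 fun {s} hs hsD => ?_
  obtain ⟨K, rfl⟩ := hsD
  exact eq_one_of_mem_Cas_of_mul_mem_degreeEq hs hB (gain_mul_mem_degreeEq K hB)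

theorem range_monoidHomSubgroup_Cas_D :
    (SemidirectProduct.monoidHomSubgroup D_le_normalizer_Cas).range = Sca := by
  rw [range_monoidHomSubgroup, Sca, Subgroup.sup_eq_closure]

theorem exists_eq_mul_gain_of_mem_Sca {s : Unimod} (hs : s ∈ Sca) :
    ∃ c ∈ Cas, ∃ K, s = c * gain K := by
  rw [← range_monoidHomSubgroup_Cas_D] at hs
  obtain ⟨⟨c, _, K, rfl⟩, rfl⟩ := hs
  exact ⟨c, c.2, K, rfl⟩

theorem eval₂_one_filt (H : Unimod) (i : Fin 2) :
    eval₂ (RingHom.id ℝ) 1 (filt H i) =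
      eval₂ (RingHom.id ℝ) 1 (H.1 i 0) + eval₂ (RingHom.id ℝ) 1 (H.1 i 1) := by
  simp [filt, eval₂_substSq]

theorem eval₂_one_filt_gain_mul (K : ℝˣ) (H : Unimod) :
    eval₂ (RingHom.id ℝ) 1 (filt (gain K * H) 0) =
      (K : ℝ)⁻¹ * eval₂ (RingHom.id ℝ) 1 (filt H 0) := by
  simp [filt_gain_mul, LaurentPolynomial.smul_eq_C_mul]

theorem eval₂_one_filt_zero_ne_zero (hH : H ∈ HS) : eval₂ (RingHom.id ℝ) 1 (filt H 0) ≠ 0 := by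
  have hsymm (i : Fin 2) : eval₂ (RingHom.id ℝ) 1 (H.1 i 0) =
      (-1) ^ (i : ℕ) * eval₂ (RingHom.id ℝ) 1 (H.1 i 1) := by
    simpa [eval₂_invert] using congrArg (eval₂ (RingHom.id ℝ) 1) (mem_HS_iff.1 hH i)
  have hdet := congrArg (eval₂ (RingHom.id ℝ) 1) (det_eq_C zero_ne_one H)
  intro hzero
  have hentry_zero : eval₂ (RingHom.id ℝ) 1 (H.1 0 1) = 0 := by
    simpa [eval₂_one_filt, hsymm] using hzero
  simp [hsymm, hentry_zero] at hdet

theorem exists_mem_Sca_mul_mem_NormBase (hH : H ∈ HS) : ∃ s ∈ Sca, s * H ∈ NormBase := by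
  obtain ⟨c, hc, hBase⟩ := exists_mem_Cas_mul_mem_Base hH
  have heval := eval₂_one_filt_zero_ne_zero hBase.1
  let K := Units.mk0 _ heval
  refine ⟨gain K * c, Sca.mul_mem (D_le_Sca ⟨K, rfl⟩) (Cas_le_Sca hc), ?_⟩
  rw [Base_eq_inter] at hBase
  rw [mul_assoc, NormBase, Base_eq_inter]
  refine ⟨⟨gain_mul_mem_HS K hBase.1, gain_mul_mem_degreeEq K hBase.2⟩, ?_⟩
  rw [eval₂_one_filt_gain_mul, Units.val_mk0, inv_mul_cancel₀ heval]

theorem eq_one_of_mem_Sca_of_mul_mem_NormBase {s B : Unimod} (hs : s ∈ Sca) (hB : B ∈ NormBase)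
    (hsB : s * B ∈ NormBase) : s = 1 := by
  rw [NormBase, Base_eq_inter] at hB hsB
  obtain ⟨c, hc, K, rfl⟩ := exists_eq_mul_gain_of_mem_Sca hs
  rw [mul_assoc] at hsB
  obtain rfl := eq_one_of_mem_Cas_of_mul_mem_degreeEq hc (gain_mul_mem_degreeEq K hB.1.2) hsB.1.2
  have hK := hsB.2
  rw [one_mul, eval₂_one_filt_gain_mul, hB.2, mul_one, inv_eq_one, Units.val_eq_one] at hK
  rw [hK, map_one, one_mul]

end Normalization

section LeftCosets

theorem mul_upsilon_notMem_HS {H : Unimod} (hH : H ∈ HS) {S : ℝ[T;T⁻¹]} (hS : S ≠ 0) :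
    H * upsilon (.ofAdd S) ∉ HS := by
  intro hHS
  have hcol_zero (i : Fin 2) : (H * upsilon (.ofAdd S)).1 i 0 = H.1 i 0 := by
    simp [Matrix.mul_apply, coe_upsilon]
  have hcol_one (i : Fin 2) : (H * upsilon (.ofAdd S)).1 i 1 = H.1 i 0 * S + H.1 i 1 := by
    simp [Matrix.mul_apply, coe_upsilon]
  have hentry (i : Fin 2) : H.1 i 0 = 0 := by
    have h := mem_HS_iff.1 hHS i
    rw [hcol_zero, hcol_one, mem_HS_iff.1 hH i] at h
    have h := mul_left_cancel₀ (pow_ne_zero _ (neg_ne_zero.2 one_ne_zero)) h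
    exact (mul_eq_zero.1 (right_eq_add.1 h)).resolve_right hS
  simpa [hentry] using det_eq_C zero_ne_one H

theorem not_exists_HS_eq_iUnion_smul {M : Subgroup Unimod} (hM : U ≤ M) :
    ¬ ∃ X : Set Unimod, HS = ⋃ A ∈ X, A • (M : Set Unimod) := by
  rintro ⟨X, hX⟩
  have hS : T 1 - T (-1) ∈ WA := by simpa using C_mul_T_sub_T_mem_WA 1 1
  have hS_ne : (T 1 - T (-1) : ℝ[T;T⁻¹]) ≠ 0 :=
    sub_ne_zero.2 fun h => absurd (congrArg degree h) (by simp)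
  exact mul_upsilon_notMem_HS haar_mem_HS hS_ne
    (mul_mem_of_eq_iUnion_smul hX haar_mem_HS (hM ⟨_, hS, rfl⟩))

end LeftCosets

section Isomorphisms

theorem lift_U_L_injective : Function.Injective (Monoid.Coprod.lift U.subtype L.subtype) :=
  lift_subtype_injective_of_pingPong (smul_mem_degreeGT zero_ne_one)
    (smul_mem_degreeGT one_ne_zero) (disjoint_degreeGT_degreeEq zero_ne_one)
    (disjoint_degreeGT_degreeEq one_ne_zero) degreeEq_nonempty

theorem range_lift_U_L : (Monoid.Coprod.lift U.subtype L.subtype).range = Cas := by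
  rw [Monoid.Coprod.range_lift, Subgroup.range_subtype, Subgroup.range_subtype, Cas,
    Subgroup.sup_eq_closure]

/-- The isomorphism `ρ : 𝒞 ≅ 𝒰 ∗ ℒ`, inverse to multiplying out the letters of a word. -/
def casEquiv : Cas ≃* Monoid.Coprod U L :=
  ((MonoidHom.ofInjective lift_U_L_injective).trans (MulEquiv.subgroupCongr range_lift_U_L)).symm

theorem casEquiv_inclusion_U (u : U) :
    casEquiv (Subgroup.inclusion U_le_Cas u) = Monoid.Coprod.inl u :=
  casEquiv.eq_symm_apply.1 rfl

theorem casEquiv_inclusion_L (l : L) :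
    casEquiv (Subgroup.inclusion L_le_Cas l) = Monoid.Coprod.inr l :=
  casEquiv.eq_symm_apply.1 rfl

theorem gamma_trans_casEquiv (d : D) :
    (gamma Cas D_le_normalizer_Cas d).trans casEquiv = casEquiv.trans (theta d) := by
  have hletters : (casEquiv.symm.trans (gamma Cas D_le_normalizer_Cas d)).toMonoidHom =
      ((theta d).trans casEquiv.symm).toMonoidHom :=
    Monoid.Coprod.hom_ext rfl rfl
  ext1 c
  rw [MulEquiv.trans_apply, ← MulEquiv.eq_symm_apply]
  simpa using DFunLike.congr_fun hletters (casEquiv c)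

theorem theta_casEquiv (d : D) (c : Cas) :
    theta d (casEquiv c) = casEquiv (gamma Cas D_le_normalizer_Cas d c) :=
  (DFunLike.congr_fun (gamma_trans_casEquiv d) c).symm

/-- The scaled lifting group as the internal semidirect product of `𝒟` and `𝒞`. -/
def semidirectEquivSca : SemidirectProduct Cas D (gamma Cas D_le_normalizer_Cas) ≃* Sca :=
  (MonoidHom.ofInjective (monoidHomSubgroup_injective D_le_normalizer_Cas disjoint_Cas_D)).trans
    (MulEquiv.subgroupCongr range_monoidHomSubgroup_Cas_D)

theorem semidirectEquivSca_inr_mul_inl (d : D) (c : Cas) :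
    semidirectEquivSca (SemidirectProduct.inr d * SemidirectProduct.inl c) =
      Subgroup.inclusion D_le_Sca d * Subgroup.inclusion Cas_le_Sca c := by
  rw [map_mul]
  exact congrArg₂ (· * ·) (Subtype.ext (one_mul (d : Unimod)))
    (Subtype.ext (mul_one (c : Unimod)))

/-- The isomorphism `ψ : 𝒮 ≅ 𝒟 ⋉ (𝒰 ∗ ℒ)` that extends `casEquiv` by the identity of `𝒟`. -/
def scaEquiv : Sca ≃* SemidirectProduct (Monoid.Coprod U L) D theta :=
  semidirectEquivSca.symm.trans
    (SemidirectProduct.congr casEquiv (MulEquiv.refl D) gamma_trans_casEquiv)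

theorem scaEquiv_mul (d : D) (c : Cas) :
    scaEquiv (Subgroup.inclusion D_le_Sca d * Subgroup.inclusion Cas_le_Sca c) =
      SemidirectProduct.inr d * SemidirectProduct.inl (casEquiv c) := by
  rw [← semidirectEquivSca_inr_mul_inl, scaEquiv, MulEquiv.trans_apply, MulEquiv.symm_apply_apply,
    map_mul]
  exact congrArg₂ (· * ·) (SemidirectProduct.ext (map_one casEquiv) rfl) rfl

end Isomorphisms

end HSBank

end

open HSBank in
theorem mainTheorem5 :
    -- `𝒮 ≅ 𝒟 ⋉_θ (𝒰 ∗ ℒ)` via `d c ↦ (d, ρ c)`, where `ρ : 𝒞 ≅ 𝒰 ∗ ℒ` fixes the letters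
    -- and `θ_d = ρ ∘ γ_d ∘ ρ⁻¹`
    (∃ (ρ : Cas ≃* Monoid.Coprod U L)
        (ψ : Sca ≃* SemidirectProduct (Monoid.Coprod U L) D theta),
      (∀ u : U, ρ (Subgroup.inclusion U_le_Cas u) = Monoid.Coprod.inl u) ∧
      (∀ l : L, ρ (Subgroup.inclusion L_le_Cas l) = Monoid.Coprod.inr l) ∧
      (∀ (d : D) (c : Cas), theta d (ρ c) = ρ (gamma Cas D_le_normalizer_Cas d c)) ∧
      (∀ (d : D) (c : Cas),
        ψ (Subgroup.inclusion D_le_Sca d * Subgroup.inclusion Cas_le_Sca c) =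
          SemidirectProduct.inr d * SemidirectProduct.inl (ρ c))) ∧
    -- partition into right cosets `𝒞 B`
    (HS = ⋃ B ∈ Base, MulOpposite.op B • (Cas : Set Unimod)) ∧
    (Base.PairwiseDisjoint fun B => MulOpposite.op B • (Cas : Set Unimod)) ∧
    -- partition into right cosets `𝒮 B`
    (HS = ⋃ B ∈ NormBase, MulOpposite.op B • (Sca : Set Unimod)) ∧
    (NormBase.PairwiseDisjoint fun B => MulOpposite.op B • (Sca : Set Unimod)) ∧
    -- no representation as a union of left cosets
    (¬ ∃ X : Set Unimod, HS = ⋃ A ∈ X, A • (Cas : Set Unimod)) ∧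
    (¬ ∃ X : Set Unimod, HS = ⋃ A ∈ X, A • (Sca : Set Unimod)) := by
  have hmul_mem : ∀ s ∈ Sca, ∀ H ∈ HS, s * H ∈ HS := fun _ hs _ hH => mul_mem_HS hs hH
  refine ⟨⟨casEquiv, scaEquiv, casEquiv_inclusion_U, casEquiv_inclusion_L, theta_casEquiv,
    scaEquiv_mul⟩, ?_, ?_, ?_, ?_, ?_, ?_⟩
  · exact eq_iUnion_op_smul (fun _ hB => hB.1) (fun c hc => hmul_mem c (Cas_le_Sca hc))
      fun _ => exists_mem_Cas_mul_mem_Base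
  · exact pairwiseDisjoint_op_smul fun c hc B hB hcB =>
      eq_one_of_mem_Cas_of_mul_mem_degreeEq hc (mem_Base_iff.1 hB).2 (mem_Base_iff.1 hcB).2
  · exact eq_iUnion_op_smul (fun _ hB => hB.1.1) hmul_mem fun _ => exists_mem_Sca_mul_mem_NormBase
  · exact pairwiseDisjoint_op_smul fun s hs B => eq_one_of_mem_Sca_of_mul_mem_NormBase hs
  · exact not_exists_HS_eq_iUnion_smul U_le_Cas
  · exact not_exists_HS_eq_iUnion_smul (U_le_Cas.trans Cas_le_Sca)
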